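/- Let $p$ be a prime, let $l\mid s$ be positive integers, $q=p^s$, and let $m\ge 2$ be an integer with $p^l\equiv 1\pmod m$. Let $H$ be an additive subgroup of $\mathbb F_q$ that is closed under multiplication by the subfield $\mathbb F_{p^l}$, with $2\le |H|<q$. Let $\alpha_1,\dots,\alpha_m$ be the $m$-th roots of unity in $\mathbb F_q$ and $$g(x)=\prod_{i=1}^{m}\prod_{h\in H}(x+h+\alpha_i)\in\mathbb F_q[x].$$ For $f\in\mathbb F_q[x]$ with $\deg f\ge 2$ let $N_f(i)$ be the number of $t\in\mathbb F_q$ such that $f(x)+t$ has exactly $i$ distinct roots in $\mathbb F_q$, and let $G(f)=N_f(\deg f)$. Then $$G(g)=\frac{q-|H|}{m|H|}\qquad\text{and}\qquad N_g(|H|)=1 .$$ For a linear code $\mathcal C\subseteq\mathbb F_q^n$, a non-empty set $R\subseteq\{1,\dots,n\}$ with $|R|\le r+\delta-1$ is called a local repair group if the punctured code $\mathcal C_R=\{(c_i)_{i\in R}: c\in\mathcal C\}$ is zero or has minimum distance at least $\delta$, and $\mathcal C$ is called an $(r,\delta)$-LRC if every coordinate lies in a local repair group. Let $m|H|-|H|+1\le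 r\le m|H|-1$, $\delta=m|H|-r+1$, $L=\frac{q-|H|}{m|H|}$, and let $k$ be an integer with $r\le k\le rL+|H|-\delta+1$. Then there is an $(r,\delta)$-LRC $\mathcal C$ over $\mathbb F_q$ of length $n=q$, dimension $k$ and minimum distance $$d=n-k-\left(\left\lceil\frac{k+m|H|-|H|}{r}\right\rceil-1\right)(\delta-1)+1,$$ which is distance-optimal in the following sense: $\mathcal C$ has $L+1$ pairwise disjoint local repair groups, $L$ of them of size $r+\delta-1$ and one of size $|H|$, and every $(r,\delta)$-LRC over $\mathbb F_q$ of length $n$ and dimension $k$ that has $L+1$ pairwise disjoint local repair groups of these sizes has minimum distance at most $d$. -/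

import Mathlib

open Polynomial

noncomputable section

/-- The minimum distance of a linear code: the least Hamming weight of a nonzero codeword
(with value `0` for the zero code, which has no nonzero codeword). -/
def minDist {F : Type*} [Field F] [DecidableEq F] {ι : Type*} [Fintype ι]
    (C : Submodule F (ι → F)) : ℕ :=
  sInf {w : ℕ | ∃ c ∈ C, c ≠ 0 ∧ hammingNorm c = w}

/-- The punctured code `C_R`: all the words `(c_i)_{i ∈ R}` for `c` in `C`. -/
def puncture {F : Type*} [Field F] {ι : Type*}
    (C : Submodule F (ι → F)) (R : Finset ι) : Submodule F (R → F) :=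
  C.map (LinearMap.funLeft F F (fun i : R => (i : ι)))

/-- `R` is a local repair group of `C` for `(r, δ)`-locality: it is a non-empty set of at most
`r + δ - 1` coordinates, and `C_R` is zero or has minimum distance at least `δ`. -/
def IsRepairGroup {F : Type*} [Field F] [DecidableEq F] {ι : Type*}
    (C : Submodule F (ι → F)) (r δ : ℕ) (R : Finset ι) : Prop :=
  R.Nonempty ∧ R.card + 1 ≤ r + δ ∧ (puncture C R = ⊥ ∨ δ ≤ minDist (puncture C R))

/-- `C` is an `(r, δ)`-LRC: each coordinate lies in a local repair group. -/
def IsLRC {F : Type*} [Field F] [DecidableEq F] {ι : Type*}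
    (C : Submodule F (ι → F)) (r δ : ℕ) : Prop :=
  ∀ i : ι, ∃ R : Finset ι, i ∈ R ∧ IsRepairGroup C r δ R

/-- `C` has `L + 1` pairwise disjoint local repair groups, of which `L` have the full size
`r + δ - 1` and the last one has size `s`. -/
def HasDisjointRepairGroups {F : Type*} [Field F] [DecidableEq F] {ι : Type*}
    (C : Submodule F (ι → F)) (r δ L s : ℕ) : Prop :=
  ∃ A : Fin (L + 1) → Finset ι,
    (∀ i j, i ≠ j → Disjoint (A i) (A j)) ∧
    (∀ i, IsRepairGroup C r δ (A i)) ∧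
    (∀ i : Fin L, (A i.castSucc).card + 1 = r + δ) ∧
    (A (Fin.last L)).card = s

/-- `C` is a distance-optimal `(r, δ)`-LRC (with respect to `L` full repair groups and one of
size `s`): it is an `(r, δ)`-LRC with such disjoint repair groups, and no `(r, δ)`-LRC of the same
length and dimension with such disjoint repair groups has a larger minimum distance. -/
def IsDistanceOptimalLRC {F : Type*} [Field F] [DecidableEq F] {ι : Type*} [Fintype ι]
    (C : Submodule F (ι → F)) (r δ L s : ℕ) : Prop :=
  IsLRC C r δ ∧ HasDisjointRepairGroups C r δ L s ∧
    ∀ C' : Submodule F (ι → F), Module.finrank F C' = Module.finrank F C →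
      IsLRC C' r δ → HasDisjointRepairGroups C' r δ L s → minDist C' ≤ minDist C

/-- `N_f(i)`: the number of `t` in `F` such that `f + t` has exactly `i` distinct roots in `F`. -/
def polyN {F : Type*} [Field F] (f : F[X]) (i : ℕ) : ℕ :=
  {t : F | {x : F | (f + C t).IsRoot x}.ncard = i}.ncard

/-- `G(f) = N_f(deg f)`. -/
def polyG {F : Type*} [Field F] (f : F[X]) : ℕ := polyN f f.natDegree

open Classical in
/-- `∏_α ∏_{h ∈ H} (x + h + α)`, where `α` runs over the `m`-th roots of unity in `F`. -/
def tamoBargPoly {F : Type*} [Field F] [Fintype F] (m : ℕ) (H : AddSubgroup F) : F[X] :=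
  ∏ α ∈ nthRootsFinset m (1 : F), ∏ h : H, (X + C (h : F) + C α)

end

noncomputable section

/-! Write `P` for the product of the `x + h` over `H`; the polynomial `g` of the theorem is the
product of the `P(x + α)`. As `H` is a `K`-space and the `m`-th roots of unity lie in `K`, `P(ax +
h) = a^|H| P(x)` for `a^m = 1` and `h ∈ H`, so `g` is invariant under the maps `x ↦ ax + h`. Outside
`H` this action is free: an orbit has `m|H| = deg g` points, hence is a whole fiber, and `H` is the
one remaining fiber (`tamoBargPoly_fiber`, `tamoBargPoly_eval_eq_zero_fiber_iff`). Counting points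
gives `q = |H| + G(g) m|H|`.

For the code put `u = r - (m-1)|H|`, so that `|H| = u + δ - 1` and `m|H| = r + δ - 1`. The code
evaluates combinations of the first `k` polynomials among `x^i` (`i < u`) and `P x^i P^(mj)` (`i <
r`). On `H` only the first `u` survive; on another fiber `P^m` is a nonzero constant `c`, and
division by `P` leaves degree less than `r`, since `x^i / P = c⁻¹ P^(m-1) x^i` there. So every fiber
is a repair group. The degrees increase strictly and the last is `k - 1 + (T+1)(δ-1)` with `T =
⌊(k-u-1)/r⌋`, which bounds the distance from below.

Conversely (`minDist_le_of_hasDisjointRepairGroups`), in any code with such groups one can impose `k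
- 1` zeros so that the small group and `T` full groups each contribute `δ - 1` further zeros for
free. The two bounds agree. -/

open Classical in
/-- The polynomial `∏_{h ∈ H} (x + h)`, whose roots are the elements of `H`. -/
def subgroupPoly {F : Type*} [Field F] [Fintype F] (H : AddSubgroup F) : F[X] :=
  ∏ h : H, (X + C (h : F))

lemma ncard_eval_eq_le {F : Type*} [Field F] {f : F[X]} (hf : 0 < f.natDegree) (v : F) :
    {y : F | f.eval y = v}.ncard ≤ f.natDegree := by
  classical
  have hne : f - C v ≠ 0 := by
    intro h0
    have := natDegree_sub_C (p := f) (a := v)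
    rw [h0, natDegree_zero] at this
    omega
  have hset : {y : F | f.eval y = v} = ((f - C v).roots.toFinset : Set F) := by
    ext y
    simp [hne, sub_eq_zero]
  rw [hset, Set.ncard_coe_finset]
  calc _ ≤ (f - C v).roots.card := Multiset.toFinset_card_le _
    _ ≤ _ := card_roots' _
    _ = _ := natDegree_sub_C

/-- The substitution `v = -t` turns roots of `f + t` into fibers of `f`. -/
lemma polyN_eq_ncard_fibers {F : Type*} [Field F] (f : F[X]) (i : ℕ) :
    polyN f i = {v : F | {x : F | f.eval x = v}.ncard = i}.ncard := by
  have : {t : F | {x : F | (f + C t).IsRoot x}.ncard = i} =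
      Neg.neg '' {v : F | {x : F | f.eval x = v}.ncard = i} := by
    ext t
    simp [add_eq_zero_iff_eq_neg]
  rw [polyN, this, Set.ncard_image_of_injective _ neg_injective]

/-! ### The subgroup polynomial and the roots of unity. -/

section Counting

variable {F : Type*} [Field F] [Fintype F]

lemma subgroupPoly_monic (H : AddSubgroup F) : (subgroupPoly H).Monic :=
  monic_prod_of_monic _ _ fun _ _ => monic_X_add_C _

lemma subgroupPoly_natDegree (H : AddSubgroup F) :
    (subgroupPoly H).natDegree = Nat.card H := by
  classical
  rw [subgroupPoly, natDegree_prod_of_monic _ _ fun _ _ => monic_X_add_C _]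
  simp [Nat.card_eq_fintype_card]

open Classical in
lemma subgroupPoly_eval (H : AddSubgroup F) (x : F) :
    (subgroupPoly H).eval x = ∏ h : H, (x + h) := by
  simp [subgroupPoly, eval_prod]

lemma subgroupPoly_eval_eq_zero_iff (H : AddSubgroup F) (x : F) :
    (subgroupPoly H).eval x = 0 ↔ x ∈ H := by
  classical
  rw [subgroupPoly_eval, Finset.prod_eq_zero_iff]
  constructor
  · rintro ⟨h, -, hx⟩
    rw [eq_neg_of_add_eq_zero_left hx]
    exact H.neg_mem h.2
  · intro hx
    exact ⟨⟨-x, H.neg_mem hx⟩, Finset.mem_univ _, by simp⟩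

lemma subgroupPoly_eval_add (H : AddSubgroup F) (x : F) {h : F} (hh : h ∈ H) :
    (subgroupPoly H).eval (x + h) = (subgroupPoly H).eval x := by
  classical
  rw [subgroupPoly_eval, subgroupPoly_eval]
  exact Fintype.prod_equiv (Equiv.addLeft (⟨h, hh⟩ : H)) _ _ fun a => by simp [add_assoc]

/-- Multiplication by `a` permutes `H`, and `ax + ah = a(x + h)`. -/
lemma subgroupPoly_eval_mul (H : AddSubgroup F) (x : F) {a : F} (ha : a ≠ 0)
    (haH : ∀ h ∈ H, a * h ∈ H) :
    (subgroupPoly H).eval (a * x) = a ^ Nat.card H * (subgroupPoly H).eval x := by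
  classical
  rw [subgroupPoly_eval, subgroupPoly_eval, Nat.card_eq_fintype_card, ← Finset.card_univ,
    ← Finset.prod_const, ← Finset.prod_mul_distrib]
  have hinj : Function.Injective (fun h : H => (⟨a * h, haH h h.2⟩ : H)) := by
    intro h h' e
    simpa [ha] using e
  exact (Fintype.prod_bijective _ (Finite.injective_iff_bijective.mp hinj) _ _
    fun h => by simp [mul_add]).symm

lemma tamoBargPoly_eq (m : ℕ) (H : AddSubgroup F) :
    tamoBargPoly m H = ∏ α ∈ nthRootsFinset m (1 : F), (subgroupPoly H).comp (X + C α) := by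
  classical
  simp only [tamoBargPoly, subgroupPoly, prod_comp]
  refine Finset.prod_congr rfl fun α _ => Finset.prod_congr rfl fun h _ => ?_
  simp only [add_comp, X_comp, C_comp]
  ring

lemma tamoBargPoly_eval (m : ℕ) (H : AddSubgroup F) (x : F) :
    (tamoBargPoly m H).eval x =
      ∏ α ∈ nthRootsFinset m (1 : F), (subgroupPoly H).eval (x + α) := by
  simp [tamoBargPoly_eq, eval_prod, eval_comp]

lemma tamoBargPoly_natDegree (m : ℕ) (H : AddSubgroup F) :
    (tamoBargPoly m H).natDegree = (nthRootsFinset m (1 : F)).card * Nat.card H := by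
  rw [tamoBargPoly_eq, natDegree_prod_of_monic _ _ fun α _ =>
    (subgroupPoly_monic H).comp (monic_X_add_C α) (by simp)]
  simp [natDegree_comp, subgroupPoly_natDegree]

/-- In a field with a subfield `K` such that `m ∣ |K| - 1`, there are `m` roots of unity of order
dividing `m`, and all of them are in `K`. -/
lemma nthRootsFinset_one_of_subfield (K : Subfield F) (m : ℕ) (hm : m ∣ Nat.card K - 1) :
    (nthRootsFinset m (1 : F)).card = m ∧ ∀ a ∈ nthRootsFinset m (1 : F), a ∈ K := by
  have hpos : 0 < Nat.card K - 1 := by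
    have := Finite.one_lt_card (α := K)
    omega
  obtain ⟨z, hz⟩ := IsCyclic.exists_ofOrder_eq_natCard (α := Kˣ)
  rw [Nat.card_units] at hz
  have hz' : IsPrimitiveRoot ((z : K) : F) (Nat.card K - 1) := by
    rw [← hz]
    exact ((IsPrimitiveRoot.orderOf z).map_of_injective (f := Units.coeHom K)
      Units.val_injective).map_of_injective (f := K.subtype) Subtype.val_injective
  obtain ⟨c, hc⟩ := hm
  have hprim : IsPrimitiveRoot (((z : K) : F) ^ c) m := hz'.pow hpos (by rw [hc, mul_comm])
  have hm0 : 0 < m := Nat.pos_of_ne_zero (by rintro rfl; simp at hc; omega)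
  refine ⟨hprim.card_nthRootsFinset, fun a ha => ?_⟩
  have : NeZero m := ⟨hm0.ne'⟩
  obtain ⟨i, -, rfl⟩ := hprim.eq_pow_of_pow_eq_one ((mem_nthRootsFinset hm0 _).mp ha)
  exact K.pow_mem (K.pow_mem (z : K).2 _) _

/-! ### Fibers of `tamoBargPoly m H` and their number. -/

section Fibers

variable {m : ℕ} {K : Subfield F} {H : AddSubgroup F}

lemma tamoBargPoly_eval_mul_add (hm : 0 < m) (hS : (nthRootsFinset m (1 : F)).card = m)
    (hK : ∀ a ∈ nthRootsFinset m (1 : F), a ∈ K) (hH : ∀ c ∈ K, ∀ h ∈ H, c * h ∈ H)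
    {a h : F} (ha : a ∈ nthRootsFinset m (1 : F)) (hh : h ∈ H) (x : F) :
    (tamoBargPoly m H).eval (a * x + h) = (tamoBargPoly m H).eval x := by
  have ham : a ^ m = 1 := (mem_nthRootsFinset hm _).mp ha
  have ha0 : a ≠ 0 := by rintro rfl; simp [hm.ne'] at ham
  rw [tamoBargPoly_eval, tamoBargPoly_eval]
  have key : ∀ b ∈ nthRootsFinset m (1 : F), (subgroupPoly H).eval (a * x + h + a * b) =
      a ^ Nat.card H * (subgroupPoly H).eval (x + b) := fun b _ => by
    rw [← subgroupPoly_eval_mul H _ ha0 (hH a (hK a ha)),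
      ← subgroupPoly_eval_add H (a * (x + b)) hh]
    ring_nf
  -- Reindexing by `b ↦ ab` lets `a` be factored out; the `m` factors `a^|H|` then multiply to
  -- `(a^m)^|H| = 1`.
  calc _ = ∏ b ∈ nthRootsFinset m (1 : F), (subgroupPoly H).eval (a * x + h + a * b) := by
        refine Finset.prod_nbij' (a⁻¹ * ·) (a * ·) ?_ ?_ ?_ ?_ ?_
        · intro b hb
          rw [mem_nthRootsFinset hm] at hb ⊢
          rw [mul_pow, inv_pow, ham, hb, inv_one, one_mul]
        · intro b hb
          rw [mem_nthRootsFinset hm] at hb ⊢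
          rw [mul_pow, ham, hb, one_mul]
        · intro b _; field_simp
        · intro b _; field_simp
        · intro b _; simp [mul_inv_cancel_left₀ ha0]
    _ = (a ^ m) ^ Nat.card H * _ := by
        rw [Finset.prod_congr rfl key, Finset.prod_mul_distrib, Finset.prod_const]
        congr 1
        rw [hS, ← pow_mul, ← pow_mul, mul_comm]
    _ = _ := by rw [ham, one_pow, one_mul]

/-- Outside `H`, the fibers of `tamoBargPoly m H` have `m |H|` elements and are the orbits of the
affine maps `x ↦ a x + h` with `a ^ m = 1` and `h ∈ H`. -/
lemma tamoBargPoly_fiber (hm : 0 < m) (hS : (nthRootsFinset m (1 : F)).card = m)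
    (hK : ∀ a ∈ nthRootsFinset m (1 : F), a ∈ K) (hH : ∀ c ∈ K, ∀ h ∈ H, c * h ∈ H)
    {x : F} (hx : x ∉ H) :
    {y : F | (tamoBargPoly m H).eval y = (tamoBargPoly m H).eval x}.ncard = m * Nat.card H ∧
    ∀ y, (tamoBargPoly m H).eval y = (tamoBargPoly m H).eval x →
      ∃ a ∈ nthRootsFinset m (1 : F), ∃ h ∈ H, y = a * x + h := by
  classical
  let o : nthRootsFinset m (1 : F) × H → F := fun z => z.1 * x + z.2
  have ho : Function.Injective o := by
    rintro ⟨a, h⟩ ⟨a', h'⟩ e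
    have e' : (a : F) * x + h = a' * x + h' := e
    -- Freeness of the action: if `a ≠ a'`, then `a - a'` is invertible in `K`, and this membership
    -- would force `x ∈ H`.
    have hxm : ((a : F) - a') * x ∈ H := by
      have : ((a : F) - a') * x = h' - h := by linear_combination e'
      rw [this]
      exact H.sub_mem h'.2 h.2
    have haa : (a : F) = a' := by
      by_contra hne
      have h0 : (a : F) - a' ≠ 0 := sub_ne_zero.mpr hne
      apply hx
      have := hH _ (K.inv_mem (K.sub_mem (hK a a.2) (hK a' a'.2))) _ hxm
      rwa [inv_mul_cancel_left₀ h0] at this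
    have hhh : (h : F) = h' := by rw [haa] at e'; exact add_left_cancel e'
    exact Prod.ext (Subtype.ext haa) (Subtype.ext hhh)
  have hcard : (Set.range o).ncard = m * Nat.card H := by
    rw [← Set.image_univ, Set.ncard_image_of_injective _ ho, Set.ncard_univ, Nat.card_prod]
    simp [hS]
  have hdeg : (tamoBargPoly m H).natDegree = m * Nat.card H := by
    rw [tamoBargPoly_natDegree, hS]
  have hpos : 0 < (tamoBargPoly m H).natDegree := by
    rw [hdeg]; exact Nat.mul_pos hm Nat.card_pos
  have hsub : Set.range o ⊆
      {y : F | (tamoBargPoly m H).eval y = (tamoBargPoly m H).eval x} := by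
    rintro _ ⟨⟨a, h⟩, rfl⟩
    exact tamoBargPoly_eval_mul_add hm hS hK hH a.2 h.2 x
  -- The orbit already has `deg g` points, the most a fiber can have.
  have heq := Set.eq_of_subset_of_ncard_le hsub
    (by rw [hcard, ← hdeg]; exact ncard_eval_eq_le hpos _) (Set.toFinite _)
  refine ⟨by rw [← heq, hcard], fun y hy => ?_⟩
  have : y ∈ Set.range o := by rw [heq]; exact hy
  obtain ⟨⟨a, h⟩, rfl⟩ := this
  exact ⟨a, a.2, h, h.2, rfl⟩

/-- Along an orbit `P` changes only by factors `a^|H|`, which the `m`-th power kills. This makes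
`P^m` a constant on each full repair group. -/
lemma subgroupPoly_eval_pow_eq (hm : 0 < m) (hS : (nthRootsFinset m (1 : F)).card = m)
    (hK : ∀ a ∈ nthRootsFinset m (1 : F), a ∈ K) (hH : ∀ c ∈ K, ∀ h ∈ H, c * h ∈ H)
    {x y : F} (hx : x ∉ H) (hy : (tamoBargPoly m H).eval y = (tamoBargPoly m H).eval x) :
    (subgroupPoly H).eval y ^ m = (subgroupPoly H).eval x ^ m := by
  obtain ⟨a, ha, h, hh, rfl⟩ := (tamoBargPoly_fiber hm hS hK hH hx).2 y hy
  have ham : a ^ m = 1 := (mem_nthRootsFinset hm _).mp ha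
  have ha0 : a ≠ 0 := by rintro rfl; simp [hm.ne'] at ham
  rw [subgroupPoly_eval_add H _ hh, subgroupPoly_eval_mul H _ ha0 (hH a (hK a ha)), mul_pow,
    ← pow_mul, mul_comm (Nat.card H), pow_mul, ham, one_pow, one_mul]

/-- If `y ∉ H` shared the value at `0`, then `0 = ay + h` would lie in the orbit of `y`, whence `y =
-a⁻¹h ∈ H`. -/
lemma tamoBargPoly_eval_eq_zero_fiber_iff (hm : 0 < m)
    (hS : (nthRootsFinset m (1 : F)).card = m)
    (hK : ∀ a ∈ nthRootsFinset m (1 : F), a ∈ K) (hH : ∀ c ∈ K, ∀ h ∈ H, c * h ∈ H) (y : F) :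
    (tamoBargPoly m H).eval y = (tamoBargPoly m H).eval 0 ↔ y ∈ H := by
  have h1 : (1 : F) ∈ nthRootsFinset m (1 : F) := (mem_nthRootsFinset hm _).mpr (one_pow m)
  have hmem : ∀ h ∈ H, (tamoBargPoly m H).eval h = (tamoBargPoly m H).eval 0 := fun h hh => by
    simpa using tamoBargPoly_eval_mul_add hm hS hK hH h1 hh 0
  refine ⟨fun hy => ?_, hmem y⟩
  by_contra hyH
  obtain ⟨a, ha, h, hh, e⟩ := (tamoBargPoly_fiber hm hS hK hH hyH).2 0 hy.symm
  have ham : a ^ m = 1 := (mem_nthRootsFinset hm _).mp ha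
  have ha0 : a ≠ 0 := by rintro rfl; simp [hm.ne'] at ham
  apply hyH
  have e' : y = a⁻¹ * -h := by
    field_simp
    linear_combination -e
  rw [e']
  exact hH _ (K.inv_mem (hK a ha)) _ (H.neg_mem hh)

lemma ncard_tamoBargPoly_fiber_zero (hm : 0 < m) (hS : (nthRootsFinset m (1 : F)).card = m)
    (hK : ∀ a ∈ nthRootsFinset m (1 : F), a ∈ K) (hH : ∀ c ∈ K, ∀ h ∈ H, c * h ∈ H) :
    {y : F | (tamoBargPoly m H).eval y = (tamoBargPoly m H).eval 0}.ncard = Nat.card H := by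
  simp only [tamoBargPoly_eval_eq_zero_fiber_iff hm hS hK hH]
  rfl

lemma polyN_tamoBargPoly_card (hm : 2 ≤ m) (hS : (nthRootsFinset m (1 : F)).card = m)
    (hK : ∀ a ∈ nthRootsFinset m (1 : F), a ∈ K) (hH : ∀ c ∈ K, ∀ h ∈ H, c * h ∈ H) :
    polyN (tamoBargPoly m H) (Nat.card H) = 1 := by
  have hm0 : 0 < m := by omega
  have hN : 0 < Nat.card H := Nat.card_pos
  rw [polyN_eq_ncard_fibers, Set.ncard_eq_one]
  refine ⟨(tamoBargPoly m H).eval 0, Set.eq_singleton_iff_unique_mem.mpr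
    ⟨ncard_tamoBargPoly_fiber_zero hm0 hS hK hH, fun v hv => ?_⟩⟩
  rw [Set.mem_ofPred_eq] at hv
  obtain ⟨x, rfl⟩ := Set.nonempty_of_ncard_ne_zero (hv.trans_ne hN.ne')
  by_cases hx : x ∈ H
  · exact (tamoBargPoly_eval_eq_zero_fiber_iff hm0 hS hK hH x).mpr hx
  · rw [(tamoBargPoly_fiber hm0 hS hK hH hx).1] at hv
    nlinarith

lemma card_eq_add_polyG_mul (hm : 2 ≤ m) (hS : (nthRootsFinset m (1 : F)).card = m)
    (hK : ∀ a ∈ nthRootsFinset m (1 : F), a ∈ K) (hH : ∀ c ∈ K, ∀ h ∈ H, c * h ∈ H) :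
    Fintype.card F = Nat.card H + polyG (tamoBargPoly m H) * (m * Nat.card H) := by
  classical
  have hm0 : 0 < m := by omega
  have hN : 0 < Nat.card H := Nat.card_pos
  set g := tamoBargPoly m H with hg
  let V : Finset F := Finset.univ.filter fun v => {x : F | g.eval x = v}.ncard = m * Nat.card H
  have hV : polyG g = V.card := by
    rw [polyG, polyN_eq_ncard_fibers, hg, tamoBargPoly_natDegree, hS, ← hg,
      ← Set.ncard_coe_finset]
    congr 1
    ext v
    simp [V]
  have hfib : ∀ v, (Finset.univ.filter fun x => g.eval x = v).card =
      {x : F | g.eval x = v}.ncard := fun v => by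
    rw [← Set.ncard_coe_finset]
    congr 1
    ext x
    simp
  have h0 : g.eval 0 ∉ V := by
    simp only [V, Finset.mem_filter, Finset.mem_univ, true_and]
    rw [ncard_tamoBargPoly_fiber_zero hm0 hS hK hH]
    intro h
    nlinarith
  -- The field is partitioned by the values of `g`: `g(0)` with fiber `H`, and those in `V`, with
  -- fibers of size `m|H|`.
  rw [← Finset.card_univ, Finset.card_eq_sum_card_fiberwise (f := fun x => g.eval x)
    (t := insert (g.eval 0) V), Finset.sum_insert h0, hfib,
    ncard_tamoBargPoly_fiber_zero hm0 hS hK hH, hV, Finset.sum_const_nat]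
  · intro v hv
    rw [hfib]
    simpa [V] using hv
  · intro x _
    by_cases hx : x ∈ H
    · have := (tamoBargPoly_eval_eq_zero_fiber_iff hm0 hS hK hH x).mpr hx
      simp [hg, this]
    · have := (tamoBargPoly_fiber hm0 hS hK hH hx).1
      simp [V, hg, this]

/-- An enumeration of the nonempty fibers of `tamoBargPoly m H`, the fiber `H` of `0` being the
last one. -/
lemma exists_tamoBargPoly_fiber_enumeration (hm : 2 ≤ m)
    (hS : (nthRootsFinset m (1 : F)).card = m)
    (hK : ∀ a ∈ nthRootsFinset m (1 : F), a ∈ K) (hH : ∀ c ∈ K, ∀ h ∈ H, c * h ∈ H) :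
    ∃ v : Fin (polyG (tamoBargPoly m H) + 1) → F, Function.Injective v ∧
      v (Fin.last _) = (tamoBargPoly m H).eval 0 ∧
      (∀ j : Fin (polyG (tamoBargPoly m H)),
        {x : F | (tamoBargPoly m H).eval x = v j.castSucc}.ncard = m * Nat.card H) ∧
      ∀ x, ∃ j, (tamoBargPoly m H).eval x = v j := by
  have hm0 : 0 < m := by omega
  have hN : 0 < Nat.card H := Nat.card_pos
  let V : Set F := {v | {x : F | (tamoBargPoly m H).eval x = v}.ncard = m * Nat.card H}
  have hV : Nat.card V = polyG (tamoBargPoly m H) := by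
    rw [polyG, polyN_eq_ncard_fibers, tamoBargPoly_natDegree, hS]
    rfl
  let e : V ≃ Fin (polyG (tamoBargPoly m H)) := (Finite.equivFin V).trans (finCongr hV)
  have h0 : (tamoBargPoly m H).eval 0 ∉ V := by
    intro h
    have h1 := ncard_tamoBargPoly_fiber_zero hm0 hS hK hH
    rw [show _ = _ from h] at h1
    nlinarith
  refine ⟨Fin.snoc (α := fun _ => F) (fun j => (e.symm j : F)) ((tamoBargPoly m H).eval 0),
    ?_, Fin.snoc_last _ _, fun j => ?_, fun x => ?_⟩
  · rw [Fin.snoc_injective_iff]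
    refine ⟨Subtype.val_injective.comp e.symm.injective, ?_⟩
    rintro ⟨j, hj⟩
    exact h0 (hj ▸ (e.symm j).2)
  · rw [Fin.snoc_castSucc]
    exact (e.symm j).2
  · by_cases hx : x ∈ H
    · exact ⟨Fin.last _, by
        rw [Fin.snoc_last, (tamoBargPoly_eval_eq_zero_fiber_iff hm0 hS hK hH x).mpr hx]⟩
    · exact ⟨(e ⟨_, (tamoBargPoly_fiber hm0 hS hK hH hx).1⟩).castSucc, by
        rw [Fin.snoc_castSucc, Equiv.symm_apply_apply]⟩

end Fibers

end Counting

/-! ### The Singleton-type upper bound on the distance. -/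

lemma exists_ne_zero_of_card_lt_finrank {F : Type*} [Field F] {ι : Type*} [Fintype ι]
    {C : Submodule F (ι → F)} {S : Finset ι}
    (hS : S.card < Module.finrank F C) : ∃ c ∈ C, c ≠ 0 ∧ ∀ i ∈ S, c i = 0 := by
  let φ : C →ₗ[F] (S → F) := (LinearMap.funLeft F F (fun i : S => (i : ι))).comp C.subtype
  have : φ.ker ≠ ⊥ := LinearMap.ker_ne_bot_of_finrank_lt (by simpa using hS)
  obtain ⟨c, hc, h0⟩ := φ.ker.exists_mem_ne_zero_of_ne_bot this
  refine ⟨c, c.2, fun h => h0 (Subtype.ext h), fun i hi => ?_⟩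
  exact congrFun (LinearMap.mem_ker.mp hc) ⟨i, hi⟩

section Bound

variable {F : Type*} [Field F] [DecidableEq F] {ι : Type*} [Fintype ι]

lemma minDist_le {C : Submodule F (ι → F)} {c : ι → F} (hc : c ∈ C) (h0 : c ≠ 0) :
    minDist C ≤ hammingNorm c := Nat.sInf_le ⟨c, hc, h0, rfl⟩

lemma le_minDist {C : Submodule F (ι → F)} (hC : C ≠ ⊥) {d : ℕ}
    (h : ∀ c ∈ C, c ≠ 0 → d ≤ hammingNorm c) : d ≤ minDist C := by
  obtain ⟨c, hc, h0⟩ := C.exists_mem_ne_zero_of_ne_bot hC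
  refine le_csInf ⟨_, c, hc, h0, rfl⟩ ?_
  rintro _ ⟨c, hc, h0, rfl⟩
  exact h c hc h0

lemma hammingNorm_le_of_eq_zero (c : ι → F) (S : Finset ι) (h : ∀ i ∈ S, c i = 0) :
    hammingNorm c + S.card ≤ Fintype.card ι := by
  classical
  have : hammingNorm c ≤ Sᶜ.card := by
    refine Finset.card_le_card fun i hi => ?_
    simp only [Finset.mem_filter, Finset.mem_univ, true_and] at hi
    rw [Finset.mem_compl]
    exact fun hS => hi (h i hS)
  have := Finset.card_compl_add_card S
  omega

/-- A codeword that vanishes on all but at most `δ - 1` coordinates of a repair group vanishes on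
the whole group. -/
lemma IsRepairGroup.eq_zero_of_subset {C : Submodule F (ι → F)} {r δ : ℕ} {R S : Finset ι}
    (hR : IsRepairGroup C r δ R) (hSR : S ⊆ R) (hS : R.card < S.card + δ) {c : ι → F}
    (hc : c ∈ C) (h0 : ∀ i ∈ S, c i = 0) : ∀ i ∈ R, c i = 0 := by
  classical
  have hmem : (fun i : R => c i) ∈ puncture C R := ⟨c, hc, rfl⟩
  by_contra! hne
  obtain ⟨i, hi, hci⟩ := hne
  have hne0 : (fun i : R => c i) ≠ 0 := fun h => hci (congrFun h ⟨i, hi⟩)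
  rcases hR.2.2 with h | h
  · rw [h, Submodule.mem_bot] at hmem
    exact hne0 hmem
  · have h1 := h.trans (minDist_le hmem hne0)
    have h2 := hammingNorm_le_of_eq_zero (fun i : R => c i)
      (S.attach.map ⟨fun s : S => (⟨s.1, hSR s.2⟩ : R), fun a b e =>
        Subtype.ext (congrArg (fun z : R => (z : ι)) e)⟩) (by
        intro j hj
        simp only [Finset.mem_map, Finset.mem_attach, true_and] at hj
        obtain ⟨s, rfl⟩ := hj
        exact h0 s s.2)
    simp only [Finset.card_map, Finset.card_attach, Fintype.card_coe] at h2
    omega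

/-- The Singleton-type bound for a code with disjoint repair groups, `T` of which are full: the
code has a nonzero word that vanishes on `T` full groups, on the small group and on enough of the
other coordinates. -/
lemma minDist_le_of_hasDisjointRepairGroups {C : Submodule F (ι → F)} {r δ L s T : ℕ}
    (hr : 0 < r) (hδ : 1 ≤ δ) (hδs : δ ≤ s) (hT : T ≤ L)
    (hn : Fintype.card ι = s + L * (r + δ - 1))
    (hk : T * r + (s + 1 - δ) < Module.finrank F C)
    (hkn : Module.finrank F C ≤ L * r + (s + 1 - δ))
    (hC : HasDisjointRepairGroups C r δ L s) :
    minDist C + Module.finrank F C + (T + 1) * (δ - 1) ≤ Fintype.card ι + 1 := by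
  classical
  obtain ⟨A, hA, hrep, hfull, hsmall⟩ := hC
  set k := Module.finrank F C
  -- the groups used
  let J : Finset (Fin (L + 1)) :=
    insert (Fin.last L) ((Finset.univ.filter fun i : Fin L => (i : ℕ) < T).map Fin.castSuccEmb)
  have hlast : Fin.last L ∉
      (Finset.univ.filter fun i : Fin L => (i : ℕ) < T).map Fin.castSuccEmb := by
    simp [(Fin.castSucc_lt_last _).ne]
  have hJT : (Finset.univ.filter fun i : Fin L => (i : ℕ) < T).card = T := by
    rw [Fin.card_filter_val_lt, min_eq_right hT]
  have hδA : ∀ i, δ ≤ (A i).card := fun i => by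
    refine Fin.lastCases ?_ (fun j => ?_) i
    · omega
    · have := hfull j; omega
  -- Zeros on `B i` propagate to all of `A i`. Such a set costs `r` conditions in a full group and
  -- `s + 1 - δ` in the small one.
  have hsub : ∀ i, ∃ S ⊆ A i, S.card = (A i).card - (δ - 1) := fun i =>
    Finset.exists_subset_card_eq (Nat.sub_le _ _)
  choose B hBA hB using hsub
  have hAd : Set.PairwiseDisjoint (J : Set (Fin (L + 1))) A := fun i _ j _ h => hA i j h
  have hBd : Set.PairwiseDisjoint (J : Set (Fin (L + 1))) B := fun i _ j _ h =>
    (hA i j h).mono (hBA i) (hBA j)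
  have hU : (J.biUnion A).card = s + T * (r + δ - 1) := by
    rw [Finset.card_biUnion hAd, Finset.sum_insert hlast, hsmall, Finset.sum_map,
      Finset.sum_const_nat (m := r + δ - 1), hJT]
    intro i _
    have := hfull i
    simp only [Fin.castSuccEmb_apply]
    omega
  have hW : (J.biUnion B).card = (s + 1 - δ) + T * r := by
    rw [Finset.card_biUnion hBd, Finset.sum_insert hlast, hB, hsmall, Finset.sum_map,
      Finset.sum_const_nat (m := r), hJT]
    · omega
    · intro i _
      have := hfull i
      simp only [Fin.castSuccEmb_apply, hB]
      omega
  obtain ⟨D, rfl⟩ := Nat.exists_eq_add_of_le hT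
  -- The `D = L - T` unused full groups leave enough room to bring the number of conditions up to
  -- exactly `k - 1`.
  have hfill : k - 1 - (T * r + (s + 1 - δ)) ≤ (J.biUnion A)ᶜ.card := by
    rw [Finset.card_compl, hU, hn]
    have : D * r ≤ D * (r + δ - 1) := Nat.mul_le_mul_left _ (by omega)
    rw [add_mul] at hkn ⊢
    omega
  obtain ⟨E, hE, hEc⟩ := Finset.exists_subset_card_eq hfill
  have hdisj : ∀ X : Finset ι, X ⊆ J.biUnion A → Disjoint X E := fun X hX =>
    (disjoint_compl_right.mono_right hE).mono_left hX
  have hBsub : J.biUnion B ⊆ J.biUnion A := Finset.biUnion_mono fun i _ => hBA i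
  obtain ⟨c, hc, hc0, hcz⟩ := exists_ne_zero_of_card_lt_finrank (C := C) (S := J.biUnion B ∪ E) (by
    rw [Finset.card_union_of_disjoint (hdisj _ hBsub), hW, hEc]
    omega)
  have hz := hammingNorm_le_of_eq_zero c (J.biUnion A ∪ E) (by
    intro i hi
    rcases Finset.mem_union.mp hi with hi | hi
    · obtain ⟨j, hj, hij⟩ := Finset.mem_biUnion.mp hi
      refine (hrep j).eq_zero_of_subset (hBA j) ?_ hc (fun x hx => hcz x ?_) i hij
      · rw [hB]
        have := hδA j
        omega
      · exact Finset.mem_union_left _ (Finset.mem_biUnion.mpr ⟨j, hj, hx⟩)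
    · exact hcz i (Finset.mem_union_right _ hi))
  rw [Finset.card_union_of_disjoint (hdisj _ subset_rfl), hU, hEc] at hz
  have hle := minDist_le hc hc0
  have h1 : T * (r + δ - 1) = T * r + T * (δ - 1) := by
    rw [← mul_add]; congr 1; omega
  rw [add_mul T 1, one_mul]
  omega

end Bound

/-! ### The evaluation code: degrees, distance and repair groups. -/

section Code

/-- Distinct degrees rule out cancellation of leading terms. -/
lemma degree_linearCombination_le {F : Type*} [Field F] {k : ℕ} {φ : ℕ → F[X]}
    (hφ : ∀ i, (φ i).Monic) (hmono : StrictMono fun i => (φ i).natDegree) {a : Fin k → F}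
    (ha : a ≠ 0) :
    ∑ i, a i • φ i ≠ 0 ∧ (∑ i, a i • φ i).natDegree ≤ (φ (k - 1)).natDegree := by
  constructor
  · intro h0
    have hdeg : ∀ i, a i ≠ 0 → (a i • φ i).degree = (φ i).natDegree := fun i hi => by
      rw [degree_smul_of_smul_regular _ (IsSMulRegular.of_ne_zero hi),
        degree_eq_natDegree (hφ i).ne_zero]
    have hsum := degree_sum_eq_of_disjoint (fun i : Fin k => a i • φ i) Finset.univ (by
      intro i hi j hj hij
      have hi' : a i ≠ 0 := fun h => hi.2 (by simp [h])
      have hj' : a j ≠ 0 := fun h => hj.2 (by simp [h])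
      simp only [Function.onFun, Function.comp]
      rw [hdeg i hi', hdeg j hj']
      intro e
      exact hij (Fin.ext (hmono.injective (by exact_mod_cast e))))
    obtain ⟨i, hi⟩ := Function.ne_iff.mp ha
    have hle : (a i • φ i).degree ≤ Finset.univ.sup fun i : Fin k => (a i • φ i).degree :=
      Finset.le_sup (f := fun i : Fin k => (a i • φ i).degree) (Finset.mem_univ i)
    rw [← hsum, h0, hdeg i hi, degree_zero] at hle
    simp at hle
  · refine natDegree_sum_le_of_forall_le _ _ fun i _ => (natDegree_smul_le _ _).trans ?_
    exact hmono.monotone (by omega)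

lemma card_le_hammingNorm_add_natDegree {F : Type*} [Field F] [DecidableEq F] {κ : Type*}
    [Fintype κ] {e : κ → F} (he : Function.Injective e) {c : κ → F} {f : F[X]} (hf : f ≠ 0)
    (hc : ∀ i, c i = 0 → f.eval (e i) = 0) :
    Fintype.card κ ≤ hammingNorm c + f.natDegree := by
  classical
  have h1 : (Finset.univ.filter fun i => c i = 0).card ≤ f.natDegree := by
    rw [← Finset.card_image_of_injective _ he]
    refine (Finset.card_le_card (t := f.roots.toFinset) fun y hy => ?_).trans
      ((Multiset.toFinset_card_le _).trans (card_roots' f))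
    obtain ⟨i, hi, rfl⟩ := Finset.mem_image.mp hy
    simpa [hf] using hc i (Finset.mem_filter.mp hi).2
  have h2 := Finset.card_filter_add_card_filter_not (s := (Finset.univ : Finset κ))
    (fun i => c i = 0)
  rw [Finset.card_univ] at h2
  have h3 : hammingNorm c = (Finset.univ.filter fun i => ¬ c i = 0).card := rfl
  omega

/-- Only the zero pattern of a word matters for its weight, so `f` may differ from the word by a
nonvanishing factor. On the full groups that factor is `P`. -/
lemma isRepairGroup_of_poly {F : Type*} [Field F] [DecidableEq F] {ι : Type*} {e : ι → F}
    (he : Function.Injective e) {C : Submodule F (ι → F)} {r δ : ℕ} {R : Finset ι}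
    (hR : R.Nonempty) (hcard : R.card + 1 ≤ r + δ)
    (hC : ∀ c ∈ C, ∃ f : F[X], f.natDegree + δ ≤ R.card ∧
      ∀ i ∈ R, (c i = 0 ↔ f.eval (e i) = 0)) : IsRepairGroup C r δ R := by
  refine ⟨hR, hcard, or_iff_not_imp_left.mpr fun hne => le_minDist hne ?_⟩
  rintro _ ⟨c, hc, rfl⟩ h0
  obtain ⟨f, hfd, hf⟩ := hC c hc
  have hf0 : f ≠ 0 := by
    rintro rfl
    exact h0 (funext fun i => (hf i i.2).mpr eval_zero)
  have := card_le_hammingNorm_add_natDegree (e := fun i : R => e i)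
    (he.comp Subtype.val_injective) (c := LinearMap.funLeft F F (fun i : R => (i : ι)) c) hf0
    fun i hi => (hf i i.2).mp hi
  rw [Fintype.card_coe] at this
  omega

/-- The basis polynomials of the code: `x ^ i` for `i < u`, then the polynomials
`P x ^ i (P ^ m) ^ j` with `i < r`, in the order of their degrees. -/
def codeBasis {F : Type*} [Field F] (P : F[X]) (m u r i : ℕ) : F[X] :=
  if i < u then X ^ i else P * (X ^ ((i - u) % r) * (P ^ m) ^ ((i - u) / r))

lemma codeBasis_monic {F : Type*} [Field F] {P : F[X]} (hP : P.Monic) (m u r i : ℕ) :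
    (codeBasis P m u r i).Monic := by
  unfold codeBasis
  split_ifs
  · exact monic_X_pow i
  · exact hP.mul ((monic_X_pow _).mul ((hP.pow m).pow _))

lemma codeBasis_natDegree {F : Type*} [Field F] {P : F[X]} (hP : P.Monic) {m u r : ℕ}
    (hr : r ≤ m * P.natDegree) (i : ℕ) :
    (codeBasis P m u r i).natDegree = if i < u then i else
      P.natDegree + ((i - u) + (i - u) / r * (m * P.natDegree - r)) := by
  unfold codeBasis
  split_ifs
  · simp
  · rw [hP.natDegree_mul ((monic_X_pow _).mul ((hP.pow m).pow _)),
      (monic_X_pow _).natDegree_mul ((hP.pow m).pow _), natDegree_X_pow,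
      (hP.pow m).natDegree_pow, hP.natDegree_pow]
    obtain ⟨t, ht⟩ := Nat.exists_eq_add_of_le hr
    have := Nat.div_add_mod (i - u) r
    rw [ht, Nat.add_sub_cancel_left]
    linarith [mul_comm r ((i - u) / r), mul_add ((i - u) / r) r t]

/-- The degree jumps by `deg P - u ≥ 0` beyond the usual step at `i = u`, and by `m deg P - r ≥ 0`
at each new power of `P^m`. -/
lemma codeBasis_natDegree_strictMono {F : Type*} [Field F] {P : F[X]} (hP : P.Monic)
    {m u r : ℕ} (hr : r ≤ m * P.natDegree) (hu : u ≤ P.natDegree) :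
    StrictMono fun i => (codeBasis P m u r i).natDegree := by
  intro i j hij
  simp only [codeBasis_natDegree hP hr]
  split_ifs
  · exact hij
  · omega
  · omega
  · have : (i - u) / r * (m * P.natDegree - r) ≤ (j - u) / r * (m * P.natDegree - r) :=
      Nat.mul_le_mul_right _ (Nat.div_le_div_right (by omega))
    omega

/-- The polynomials with coefficients `a` in `codeBasis`, evaluated at the points `e`. -/
def encode {F : Type*} [Field F] {ι : Type*} (e : ι → F) (P : F[X]) (m u r k : ℕ) :
    (Fin k → F) →ₗ[F] (ι → F) :=
  (LinearMap.pi fun i => leval (e i)).comp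
    (Fintype.linearCombination F fun i : Fin k => codeBasis P m u r i)

lemma encode_apply {F : Type*} [Field F] {ι : Type*} (e : ι → F) (P : F[X]) (m u r k : ℕ)
    (a : Fin k → F) (x : ι) :
    encode e P m u r k a x = (∑ i, a i • codeBasis P m u r i).eval (e x) := by
  simp only [encode, LinearMap.comp_apply, Fintype.linearCombination_apply, LinearMap.pi_apply,
    leval_apply]

section Params

variable {F : Type*} [Field F] [DecidableEq F] {ι : Type*} {e : ι → F}
  {P : F[X]} {m u r k : ℕ}

lemma le_hammingNorm_encode [Fintype ι] (he : Function.Injective e) (hP : P.Monic)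
    (hr : r ≤ m * P.natDegree) (hu : u ≤ P.natDegree) {a : Fin k → F} (ha : a ≠ 0) :
    Fintype.card ι ≤
      hammingNorm (encode e P m u r k a) + (codeBasis P m u r (k - 1)).natDegree := by
  obtain ⟨h0, hd⟩ := degree_linearCombination_le (codeBasis_monic hP m u r)
    (codeBasis_natDegree_strictMono hP hr hu) ha
  have := card_le_hammingNorm_add_natDegree he (c := encode e P m u r k a) h0
    fun i hi => by rwa [encode_apply] at hi
  omega

lemma encode_injective [Fintype ι] (he : Function.Injective e) (hP : P.Monic)
    (hr : r ≤ m * P.natDegree) (hu : u ≤ P.natDegree)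
    (hk : (codeBasis P m u r (k - 1)).natDegree < Fintype.card ι) :
    Function.Injective (encode e P m u r k) := by
  rw [← LinearMap.ker_eq_bot, LinearMap.ker_eq_bot']
  intro a h0
  by_contra ha
  have := le_hammingNorm_encode he hP hr hu ha
  rw [h0, hammingNorm_zero] at this
  omega

lemma isRepairGroup_encode_of_root (he : Function.Injective e) {δ : ℕ} {R : Finset ι}
    (hu : 0 < u) (hδ : u + δ ≤ R.card + 1) (hcard : R.card + 1 ≤ r + δ)
    (hne : R.Nonempty) (hR : ∀ x ∈ R, P.eval (e x) = 0) :
    IsRepairGroup (encode e P m u r k).range r δ R := by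
  refine isRepairGroup_of_poly he hne hcard ?_
  rintro _ ⟨a, rfl⟩
  -- All basis polynomials from index `u` on are multiples of `P`, which vanishes on `R`.
  refine ⟨∑ i : Fin k, a i • if (i : ℕ) < u then X ^ (i : ℕ) else 0, ?_, fun x hx => ?_⟩
  · have : (∑ i : Fin k, a i • if (i : ℕ) < u then (X ^ (i : ℕ) : F[X]) else 0).natDegree
        ≤ u - 1 := by
      refine natDegree_sum_le_of_forall_le _ _ fun i _ => (natDegree_smul_le _ _).trans ?_
      split_ifs
      · rw [natDegree_X_pow]; omega
      · simp
    omega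
  · rw [encode_apply, eval_finsetSum, eval_finsetSum]
    refine Eq.congr_left (Finset.sum_congr rfl fun i _ => ?_)
    rw [codeBasis]
    split_ifs <;> simp [hR x hx]

lemma isRepairGroup_encode_of_pow_eq (he : Function.Injective e) {δ : ℕ} {R : Finset ι} {c : F}
    (hP : P.Monic) (hm : 0 < m) (hr : (m - 1) * P.natDegree + u = r) (hr0 : 0 < r)
    (hδ : R.card + 1 = r + δ) (hne : R.Nonempty) (hc : c ≠ 0)
    (hR : ∀ x ∈ R, P.eval (e x) ^ m = c) :
    IsRepairGroup (encode e P m u r k).range r δ R := by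
  refine isRepairGroup_of_poly he hne hδ.le ?_
  rintro _ ⟨a, rfl⟩
  -- The word divided by `P`, reduced with `P^m = c`. The first kind of term has degree at most
  -- `(m-1) deg P + u - 1 = r - 1`, which is where the value of `u` comes from.
  refine ⟨∑ i : Fin k, a i • if (i : ℕ) < u then C c⁻¹ * (P ^ (m - 1) * X ^ (i : ℕ))
    else C (c ^ ((i - u) / r)) * X ^ ((i - u) % r), ?_, fun x hx => ?_⟩
  · have : (∑ i : Fin k, a i • if (i : ℕ) < u then C c⁻¹ * (P ^ (m - 1) * X ^ (i : ℕ))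
        else C (c ^ ((i - u) / r)) * X ^ ((i - u) % r)).natDegree ≤ r - 1 := by
      refine natDegree_sum_le_of_forall_le _ _ fun i _ => (natDegree_smul_le _ _).trans ?_
      split_ifs
      · refine (natDegree_C_mul_le _ _).trans ?_
        rw [(hP.pow _).natDegree_mul (monic_X_pow _), hP.natDegree_pow, natDegree_X_pow]
        omega
      · refine (natDegree_C_mul_X_pow_le _ _).trans ?_
        have := Nat.mod_lt (i - u) hr0
        omega
    omega
  · have hPx : P.eval (e x) ≠ 0 := by
      intro h
      have := hR x hx
      rw [h, zero_pow hm.ne'] at this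
      exact hc this.symm
    refine Iff.trans ?_ (mul_eq_zero.trans (or_iff_right hPx))
    rw [encode_apply, eval_finsetSum, eval_finsetSum, Finset.mul_sum]
    refine Eq.congr_left (Finset.sum_congr rfl fun i _ => ?_)
    rw [codeBasis]
    split_ifs
    · have hpow : P.eval (e x) * P.eval (e x) ^ (m - 1) = c := by
        rw [← pow_succ', Nat.sub_add_cancel hm, hR x hx]
      simp only [eval_smul, eval_mul, eval_pow, eval_X, eval_C, smul_eq_mul]
      field_simp
      linear_combination (-a i * e x ^ (i : ℕ)) * hpow
    · simp only [eval_smul, eval_mul, eval_pow, eval_X, eval_C, smul_eq_mul, hR x hx]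
      ring

end Params

end Code

/-! ### Repair groups from fibers, and optimality. -/

lemma card_eq_ncard_fiber {F : Type*} [Field F] {ι : Type*} [Fintype ι] (e : ι ≃ F) (s : Set F)
    [DecidablePred (· ∈ s)] : (Finset.univ.filter fun i => e i ∈ s).card = s.ncard := by
  rw [← Set.ncard_coe_finset, ← Set.ncard_image_of_injective _ e.injective]
  congr 1
  ext x
  simp only [Finset.coe_filter, Finset.mem_univ, true_and, Set.mem_image, Set.mem_ofPred_eq]
  constructor
  · rintro ⟨i, hi, rfl⟩
    exact hi
  · exact fun hx => ⟨e.symm x, by simpa using hx, by simp⟩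

/-- The code spanned by the evaluations of `codeBasis` has the repair groups given by the fibers
of `tamoBargPoly m H`. -/
lemma isLRC_encode_tamoBargPoly {F : Type*} [Field F] [Fintype F] [DecidableEq F] {ι : Type*}
    [Fintype ι] (e : ι ≃ F) {m : ℕ} {K : Subfield F} {H : AddSubgroup F} (hm : 2 ≤ m)
    (hS : (nthRootsFinset m (1 : F)).card = m)
    (hK : ∀ a ∈ nthRootsFinset m (1 : F), a ∈ K) (hH : ∀ c ∈ K, ∀ h ∈ H, c * h ∈ H)
    {r δ u k : ℕ} (hu : 0 < u) (hr : (m - 1) * Nat.card H + u = r) (hδ : u + δ = Nat.card H + 1) :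
    IsLRC (encode e (subgroupPoly H) m u r k).range r δ ∧
      HasDisjointRepairGroups (encode e (subgroupPoly H) m u r k).range r δ
        (polyG (tamoBargPoly m H)) (Nat.card H) := by
  have hm0 : 0 < m := by omega
  have hN : 0 < Nat.card H := Nat.card_pos
  obtain ⟨v, hvinj, hv0, hv, hcov⟩ := exists_tamoBargPoly_fiber_enumeration hm hS hK hH
  have hmN : m * Nat.card H = (m - 1) * Nat.card H + Nat.card H := by
    rw [← Nat.succ_mul, Nat.succ_eq_add_one, Nat.sub_add_cancel hm0]
  let A : Fin (polyG (tamoBargPoly m H) + 1) → Finset ι := fun j =>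
    Finset.univ.filter fun i => (tamoBargPoly m H).eval (e i) = v j
  have hmem : ∀ i j, i ∈ A j ↔ (tamoBargPoly m H).eval (e i) = v j := fun i j => by simp [A]
  have hAcard : ∀ j, (A j).card = {x : F | (tamoBargPoly m H).eval x = v j}.ncard := fun j => by
    classical
    rw [← card_eq_ncard_fiber e]
    congr 1
  have hlast : (A (Fin.last _)).card = Nat.card H := by
    rw [hAcard, hv0, ncard_tamoBargPoly_fiber_zero hm0 hS hK hH]
  have hfull : ∀ j : Fin (polyG (tamoBargPoly m H)), (A j.castSucc).card + 1 = r + δ :=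
    fun j => by rw [hAcard, hv j]; omega
  have hrep : ∀ j, IsRepairGroup (encode e (subgroupPoly H) m u r k).range r δ (A j) := by
    intro j
    refine Fin.lastCases ?_ (fun j => ?_) j
    · refine isRepairGroup_encode_of_root e.injective hu (by omega) (by omega)
        (Finset.card_pos.mp (by omega)) fun x hx => ?_
      rw [hmem, hv0, tamoBargPoly_eval_eq_zero_fiber_iff hm0 hS hK hH] at hx
      exact (subgroupPoly_eval_eq_zero_iff H _).mpr hx
    · have hne : (A j.castSucc).Nonempty := Finset.card_pos.mp (by have := hfull j; omega)
      obtain ⟨x, hx⟩ := hne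
      rw [hmem] at hx
      have hxH : e x ∉ H := by
        intro h
        rw [(tamoBargPoly_eval_eq_zero_fiber_iff hm0 hS hK hH _).mpr h, ← hv0] at hx
        exact (Fin.castSucc_lt_last j).ne' (hvinj hx)
      refine isRepairGroup_encode_of_pow_eq (c := (subgroupPoly H).eval (e x) ^ m) e.injective
        (subgroupPoly_monic H) hm0 (by rw [subgroupPoly_natDegree, hr]) (by omega) (hfull j)
        ⟨x, (hmem _ _).mpr hx⟩ (pow_ne_zero _ ?_) fun y hy => ?_
      · rwa [Ne, subgroupPoly_eval_eq_zero_iff]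
      · rw [hmem, ← hx] at hy
        exact subgroupPoly_eval_pow_eq hm0 hS hK hH hxH hy
  refine ⟨fun i => ?_, A, fun i j hij => ?_, hrep, hfull, hlast⟩
  · obtain ⟨j, hj⟩ := hcov (e i)
    exact ⟨A j, (hmem _ _).mpr hj, hrep j⟩
  · rw [Finset.disjoint_left]
    intro x hx hx'
    rw [hmem] at hx hx'
    exact hij (hvinj (hx.symm.trans hx'))

/-- The evaluation code attains the Singleton-type bound for disjoint repair groups. -/
lemma isDistanceOptimalLRC_encode {F : Type*} [Field F] [Fintype F] [DecidableEq F] {ι : Type*}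
    [Fintype ι] (e : ι ≃ F) {m : ℕ} {K : Subfield F} {H : AddSubgroup F} (hm : 2 ≤ m)
    (hS : (nthRootsFinset m (1 : F)).card = m)
    (hK : ∀ a ∈ nthRootsFinset m (1 : F), a ∈ K) (hH : ∀ c ∈ K, ∀ h ∈ H, c * h ∈ H)
    {r δ u k : ℕ} (hu : 0 < u) (hr : (m - 1) * Nat.card H + u = r) (hδ : u + δ = Nat.card H + 1)
    (hδ1 : 1 ≤ δ) (huk : u < k) (hk : k ≤ polyG (tamoBargPoly m H) * r + u) :
    Module.finrank F (encode e (subgroupPoly H) m u r k).range = k ∧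
      IsDistanceOptimalLRC (encode e (subgroupPoly H) m u r k).range r δ
        (polyG (tamoBargPoly m H)) (Nat.card H) ∧
      minDist (encode e (subgroupPoly H) m u r k).range + k + ((k - u - 1) / r + 1) * (δ - 1) =
        Fintype.card ι + 1 := by
  have hm0 : 0 < m := by omega
  have hN : 0 < Nat.card H := Nat.card_pos
  have hr0 : 0 < r := by omega
  have hmN : m * Nat.card H = (m - 1) * Nat.card H + Nat.card H := by
    rw [← Nat.succ_mul, Nat.succ_eq_add_one, Nat.sub_add_cancel hm0]
  have hcard : Fintype.card ι =
      Nat.card H + polyG (tamoBargPoly m H) * (r + δ - 1) := by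
    rw [Fintype.card_congr e, card_eq_add_polyG_mul hm hS hK hH]
    congr 2
    omega
  obtain ⟨hlrc, hgroups⟩ := isLRC_encode_tamoBargPoly (k := k) e hm hS hK hH hu hr hδ
  set L := polyG (tamoBargPoly m H)
  -- The exponent of `P^m` in the last basis polynomial, and also the number of full groups used in
  -- the upper bound.
  set T := (k - u - 1) / r
  have hP := subgroupPoly_monic H
  have hPd := subgroupPoly_natDegree H
  have hrP : r ≤ m * (subgroupPoly H).natDegree := by rw [hPd]; omega
  have huP : u ≤ (subgroupPoly H).natDegree := by rw [hPd]; omega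
  have hTL : T < L := (Nat.div_lt_iff_lt_mul hr0).mpr (by omega)
  have hTr : T * r ≤ k - u - 1 := Nat.div_mul_le_self _ _
  -- Both jumps in degree equal `δ - 1`: `|H| - u` occurs once and `m|H| - r` occurs `T` times.
  have hdeg : (codeBasis (subgroupPoly H) m u r (k - 1)).natDegree =
      k - 1 + (T + 1) * (δ - 1) := by
    rw [codeBasis_natDegree hP hrP, if_neg (by omega), hPd,
      show m * Nat.card H - r = δ - 1 by omega, show k - 1 - u = k - u - 1 by omega, add_mul,
      show (k - u - 1) / r = T from rfl]
    omega
  have hlt : (codeBasis (subgroupPoly H) m u r (k - 1)).natDegree < Fintype.card ι := by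
    have h1 : (T + 1) * (δ - 1) ≤ L * (δ - 1) := Nat.mul_le_mul_right _ hTL
    have h2 : L * (r + δ - 1) = L * r + L * (δ - 1) := by
      rw [← mul_add]; congr 1; omega
    rw [hdeg, hcard, h2]
    omega
  have hfin : Module.finrank F (encode e (subgroupPoly H) m u r k).range = k := by
    rw [LinearMap.finrank_range_of_inj (encode_injective e.injective hP hrP huP hlt)]
    simp
  have hbound : ∀ C' : Submodule F (ι → F), Module.finrank F C' = k →
      HasDisjointRepairGroups C' r δ L (Nat.card H) →
      minDist C' + k + (T + 1) * (δ - 1) ≤ Fintype.card ι + 1 := by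
    intro C' hC' hg
    have := minDist_le_of_hasDisjointRepairGroups (T := T) hr0 hδ1 (by omega) hTL.le hcard
      (by omega) (by omega) hg
    rwa [hC'] at this
  have hlow : Fintype.card ι ≤ minDist (encode e (subgroupPoly H) m u r k).range +
      (codeBasis (subgroupPoly H) m u r (k - 1)).natDegree := by
    rw [← tsub_le_iff_right]
    refine le_minDist (fun h => ?_) ?_
    · rw [h, finrank_bot] at hfin
      omega
    · rintro _ ⟨a, rfl⟩ hne
      rw [tsub_le_iff_right]
      exact le_hammingNorm_encode e.injective hP hrP huP fun h => hne (by rw [h, map_zero])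
  have heq : minDist (encode e (subgroupPoly H) m u r k).range + k + (T + 1) * (δ - 1) =
      Fintype.card ι + 1 := by
    have := hbound _ hfin hgroups
    omega
  refine ⟨hfin, ⟨hlrc, hgroups, fun C' hC' _ hg => ?_⟩, heq⟩
  have := hbound C' (hC'.trans hfin) hg
  omega

end

theorem mainTheorem5 {F : Type*} [Field F] [Fintype F] [DecidableEq F]
    (p l s m : ℕ) (hp : p.Prime) (hcard : Fintype.card F = p ^ s)
    (hls : l ∣ s) (hm : p ^ l ≡ 1 [MOD m])
    (K : Subfield F) (hK : Nat.card K = p ^ l)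
    (H : AddSubgroup F) (hH : ∀ c ∈ K, ∀ h ∈ H, c * h ∈ H)
    (hm2 : 2 ≤ m) (hH2 : 2 ≤ Nat.card H) (hHq : Nat.card H < Fintype.card F) :
    (polyG (tamoBargPoly m H) : ℚ)
        = ((Fintype.card F : ℚ) - Nat.card H) / ((m : ℚ) * Nat.card H) ∧
    polyN (tamoBargPoly m H) (Nat.card H) = 1 ∧
    ∀ r δ k : ℕ,
      (m : ℤ) * Nat.card H - Nat.card H + 1 ≤ r → (r : ℤ) ≤ (m : ℤ) * Nat.card H - 1 →
      (δ : ℤ) = (m : ℤ) * Nat.card H - r + 1 →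
      r ≤ k →
      (k : ℚ) ≤ (r : ℚ) * (((Fintype.card F : ℚ) - Nat.card H) / ((m : ℚ) * Nat.card H))
        + Nat.card H - δ + 1 →
      ∃ C : Submodule F (Fin (Fintype.card F) → F),
        Module.finrank F C = k ∧
        IsDistanceOptimalLRC C r δ (polyG (tamoBargPoly m H)) (Nat.card H) ∧
        (minDist C : ℤ) = (Fintype.card F : ℤ) - k
          - (⌈((k : ℚ) + (m : ℚ) * Nat.card H - Nat.card H) / (r : ℚ)⌉ - 1) * ((δ : ℤ) - 1)
          + 1 := by
  have hN : 0 < Nat.card H := Nat.card_pos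
  have hpl : 1 ≤ p ^ l := Nat.one_le_pow _ _ hp.pos
  obtain ⟨hS, hSK⟩ := nthRootsFinset_one_of_subfield K m
    (by rw [hK]; exact (Nat.modEq_iff_dvd' hpl).mp hm.symm)
  have hq := card_eq_add_polyG_mul hm2 hS hSK hH
  have hG : (polyG (tamoBargPoly m H) : ℚ) =
      ((Fintype.card F : ℚ) - Nat.card H) / ((m : ℚ) * Nat.card H) := by
    have hmN : (m : ℚ) * Nat.card H ≠ 0 := by positivity
    rw [eq_div_iff hmN, hq]
    push_cast
    ring
  refine ⟨hG, polyN_tamoBargPoly_card hm2 hS hSK hH, ?_⟩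
  rw [← hG]
  intro r δ k hr1 hr2 hδ hrk hk
  -- With `m' = m - 1` the integer constraints become subtraction-free and linear in `m' * |H|`.
  obtain ⟨m', rfl⟩ := Nat.exists_eq_add_of_le' (show 1 ≤ m by omega)
  have hrδ : r + δ = m' * Nat.card H + Nat.card H + 1 := by
    zify
    push_cast at hδ
    linarith
  have hr1' : m' * Nat.card H + 1 ≤ r := by
    zify
    push_cast at hr1
    linarith
  have hr2' : r + 1 ≤ m' * Nat.card H + Nat.card H := by
    zify
    push_cast at hr2
    linarith
  have hk' : k + δ ≤ polyG (tamoBargPoly (m' + 1) H) * r + Nat.card H + 1 := by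
    have : (k : ℚ) + δ ≤ polyG (tamoBargPoly (m' + 1) H) * r + Nat.card H + 1 := by linarith
    exact_mod_cast this
  obtain ⟨u, rfl⟩ := Nat.exists_eq_add_of_le (Nat.le_of_succ_le hr1')
  have hN' : 0 < m' * Nat.card H := Nat.mul_pos (by omega) hN
  obtain ⟨hfin, hopt, hdist⟩ := isDistanceOptimalLRC_encode (r := m' * Nat.card H + u) (δ := δ)
    (u := u) (k := k) (Fintype.equivFin F).symm hm2 hS hSK hH (by omega) (by simp) (by omega)
    (by omega) (by omega) (by omega)
  refine ⟨_, hfin, hopt, ?_⟩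
  set r := m' * Nat.card H + u with hr
  -- The numerator is `k + r - u`, so the ceiling is `⌈(k-u)/r⌉ + 1`, and `⌈(k-u)/r⌉ = ⌊(k-u-1)/r⌋ +
  -- 1` as `k > u`.
  have hceil : ⌈((k : ℚ) + ((m' + 1 : ℕ) : ℚ) * Nat.card H - Nat.card H) / (r : ℚ)⌉ =
      ((k - u - 1) / r : ℕ) + 2 := by
    have hr0 : 0 < r := by omega
    have hr0' : (0 : ℚ) < r := by exact_mod_cast hr0
    have h1 : r * ((k - u - 1) / r) + u + 1 ≤ k := by
      have := Nat.mul_div_le (k - u - 1) r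
      omega
    have h2 : k ≤ r * ((k - u - 1) / r) + r + u := by
      have := Nat.lt_mul_div_succ (k - u - 1) hr0
      rw [mul_add] at this
      omega
    generalize (k - u - 1) / r = T at h1 h2
    have hrq : (r : ℚ) = m' * Nat.card H + u := by rw [hr]; push_cast; ring
    have h1' : (r : ℚ) * T + u + 1 ≤ k := by exact_mod_cast h1
    have h2' : (k : ℚ) ≤ r * T + r + u := by exact_mod_cast h2
    rw [Int.ceil_eq_iff, lt_div_iff₀ hr0', div_le_iff₀ hr0']
    push_cast
    constructor <;> linarith
  have hδ1 : 1 ≤ δ := by omega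
  rw [hceil]
  rw [Fintype.card_fin] at hdist
  zify [hδ1] at hdist
  push_cast
  linarith
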